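/- Let $X$ be a separable real Banach space. A Borel set $E\subseteq X$ is called \emph{Haar null} if there is a Borel probability measure $\mu$ on $X$ such that $\mu(x+E)=0$ for every $x\in X$, and \emph{Haar positive} if it is not Haar null. A Borel set $E\subseteq X$ is called \emph{Haar meagre} if there are a nonempty compact metric space $M$ and a continuous function $f\colon M\to X$ such that $f^{-1}(x+E)$ is meagre in $M$ for every $x\in X$. Let $C\subseteq X$ be a closed, convex set. Then $C$ is Haar positive if and only if $C$ is not Haar meagre. Equivalently, $C$ is Haar null if and only if $C$ is Haar meagre. -/

import Mathlib

open Set Topology MeasureTheory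

universe u

/-- A Borel set `E` in a (not necessarily commutative, additively written) Polish group `G` is
*Haar null* if some Borel probability measure on `G` vanishes on every two-sided translate
`g + E + h` of `E`. -/
def HaarNull {G : Type u} [AddGroup G] [TopologicalSpace G] [MeasurableSpace G] [BorelSpace G]
    (E : Set G) : Prop :=
  MeasurableSet E ∧
    ∃ μ : Measure G, IsProbabilityMeasure μ ∧ ∀ g h : G, μ ((fun x => g + x + h) '' E) = 0

/-- A Borel set is *Haar positive* if it is not Haar null. -/
def HaarPositive {G : Type u} [AddGroup G] [TopologicalSpace G] [MeasurableSpace G]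
    [BorelSpace G] (E : Set G) : Prop :=
  MeasurableSet E ∧ ¬ HaarNull E

/-- A Borel set `E` in a Polish group `G` is *Haar meagre* if there are a nonempty compact metric
space `M` and a continuous `f : M → G` such that the preimage under `f` of every two-sided
translate `g + E + h` is meagre in `M`. (Every compact metric space is homeomorphic to one in any
given universe, so the universe chosen for `M` is immaterial.) -/
def HaarMeagre {G : Type u} [AddGroup G] [TopologicalSpace G] [MeasurableSpace G] [BorelSpace G]
    (E : Set G) : Prop :=
  MeasurableSet E ∧
    ∃ (M : Type u) (_ : MetricSpace M) (_ : CompactSpace M) (_ : Nonempty M) (f : M → G),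
      Continuous f ∧ ∀ g h : G, IsMeagre (f ⁻¹' ((fun x => g + x + h) '' E))

/-!
One implication holds for every closed set: by tightness a probability measure witnessing Haar
nullness may be restricted to a compact set, and the inclusion of the support of the restriction
witnesses Haar meagreness, because a closed null subset of the support has empty relative interior
(`HaarNull.haarMeagre`).

The converse rests on a dichotomy for a closed convex set `C` (`haarNull_or_finite_translates`):
either `C` is Haar null, or there are `r > 0` and `L` such that every finite subset of the ball of
radius `r` is translated into `C` by a vector of norm at most `L`. In the second case every compact
subset of the ball of radius `r / 2` has a translate in `C`: its points are series `∑ 2⁻⁽ⁿ⁺¹⁾ zₙ`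
with `zₙ` in a finite subset, depending on `n` only, of the ball of radius `r`, and the bound `L`
makes the weighted sum of the translation vectors converge (`exists_translate_subset_of_isCompact`). Hence, for a continuous `f`
on a compact space, a small neighbourhood of any given point is mapped into a translate of `C`, and
`C` is not Haar meagre.

If the second case fails, there are finite sets `F n` of radius `2⁻ⁿ` without a translate in
`E n = C ∩ closedBall 0 n`. The key point (`exists_weights_of_no_translate`) is that `3 • F n` then
carries a probability measure giving mass at most `7/8` to every translate of `E n`, where neither
constant depends on the cardinality of `F n`. Otherwise the minimax principle
(`exists_weights_cover`) provides a random translate such that each point of `3 • F n` is covered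
with probability at least `3/4`, by translates covering at least three quarters of the points.
Averaging, with an uncovered point replaced by the mean of the covered ones, yields points of `E n`
whose coefficients in terms of `3 • F n` form a stochastic matrix: a diagonal with entries at least
`3/4` plus a remainder with entries at most `1/(3m)`, where `m` is the cardinality of `F n`. The
negative entries of its inverse are `O(1/m)`, so they are compensated by a multiple of the uniform
average, and a translate of `F n` lies in `E n` after all (`exists_stochastic_mul_eq`).

The law of a random series with independent terms distributed according to these measures vanishes
on every translate of each `E N` (`measure_random_series_mem_eq_zero`), hence of `C`: the event `A`
that the series lies in a given translate is the decreasing limit of events `B n`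
depending on the first `n` terms only, and the bound `7/8` for the `n`-th term gives
`μ A ≤ 7/8 * μ (B n)`.
-/

/-! ### Finite convex geometry -/

/-- The minimax principle for a finite covering game: if, for every distribution `w` on `J`, some
member of `𝒢` has `w`-mass at least `t`, then some distribution `q` on `𝒢` covers every point of `J`
with probability at least `t`. -/
theorem exists_weights_cover {J : Type*} [Fintype J] [DecidableEq J] [Nonempty J]
    (𝒢 : Finset (Finset J)) (t : ℝ)
    (h : ∀ w : J → ℝ, (∀ j, 0 ≤ w j) → ∑ j, w j = 1 → ∃ G ∈ 𝒢, t ≤ ∑ j ∈ G, w j) :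
    ∃ q : Finset J → ℝ, (∀ G ∈ 𝒢, 0 ≤ q G) ∧ ∑ G ∈ 𝒢, q G = 1 ∧
      ∀ j, t ≤ ∑ G ∈ 𝒢, if j ∈ G then q G else 0 := by
  classical
  let ind : Finset J → J → ℝ := fun G j => if j ∈ G then 1 else 0
  by_cases hd : Disjoint (convexHull ℝ (ind '' (𝒢 : Set (Finset J)))) {v : J → ℝ | ∀ j, t ≤ v j}
  · exfalso
    have hT : {v : J → ℝ | ∀ j, t ≤ v j} = Set.Ici (fun _ => t) := by
      ext v; simp [Pi.le_def]
    rw [hT] at hd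
    obtain ⟨φ, a, b, hφ, hab, hφ'⟩ := geometric_hahn_banach_compact_closed (convex_convexHull ℝ _)
      (((𝒢.finite_toSet.image ind).isCompact_convexHull ℝ)) (convex_Ici _) isClosed_Ici hd
    let e : J → J → ℝ := fun j => Pi.single j 1
    have hrep : ∀ v : J → ℝ, φ v = ∑ j, v j * φ (e j) := by
      intro v
      conv_lhs => rw [pi_eq_sum_univ' v]
      simp [e, map_sum]
    have hb0 : b < φ (fun _ => t) := hφ' _ (by simp)
    have hnn : ∀ j, 0 ≤ φ (e j) := by
      intro j
      by_contra! hneg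
      -- moving far along the `j`-th axis inside the orthant contradicts the lower bound `b`
      have h1 := hφ' ((fun _ => t) + ((φ (fun _ => t) - b) / (-φ (e j))) • e j) (by
        rw [Set.mem_Ici]
        refine le_add_of_nonneg_right ?_
        refine smul_nonneg (div_nonneg (by linarith) (by linarith)) ?_
        simp [e, Pi.le_def, Pi.single_apply]
        intro k; split_ifs <;> norm_num)
      rw [map_add, map_smul, smul_eq_mul] at h1
      have : (φ (fun _ => t) - b) / (-φ (e j)) * φ (e j) = -(φ (fun _ => t) - b) := by
        rw [div_neg, neg_mul, div_mul_cancel₀ _ hneg.ne]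
      linarith
    set s := ∑ j, φ (e j) with hs
    have hs0 : 0 ≤ s := Finset.sum_nonneg fun j _ => hnn j
    have ht : φ (fun _ => t) = t * s := by rw [hrep, hs, Finset.mul_sum]
    have hind : ∀ G ∈ 𝒢, ∑ j ∈ G, φ (e j) < t * s := by
      intro G hG
      have := hφ _ (subset_convexHull ℝ _ (Set.mem_image_of_mem ind hG))
      rw [hrep] at this
      simp only [ind, ite_mul, one_mul, zero_mul, Finset.sum_ite_mem, Finset.univ_inter] at this
      linarith
    obtain ⟨G₀, hG₀, -⟩ := h (fun _ => (Fintype.card J : ℝ)⁻¹) (by intro; positivity) (by simp)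
    rcases hs0.eq_or_lt with h0 | hpos
    · have := hind G₀ hG₀
      rw [← h0, mul_zero] at this
      exact absurd this (not_lt.2 (Finset.sum_nonneg fun j _ => hnn j))
    · obtain ⟨G, hG, hGt⟩ := h (fun j => φ (e j) / s) (fun j => div_nonneg (hnn j) hs0)
        (by rw [← Finset.sum_div, div_self hpos.ne'])
      rw [← Finset.sum_div, le_div_iff₀ hpos] at hGt
      exact absurd (hind G hG) (not_lt.2 hGt)
  · rw [Set.not_disjoint_iff] at hd
    obtain ⟨v, hv, hvt⟩ := hd
    have hv' : v ∈ convexHull ℝ (((𝒢.image ind : Finset (J → ℝ))) : Set (J → ℝ)) := by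
      simpa using hv
    have hinj : Function.Injective ind := by
      intro G H hGH
      ext j
      have := congrFun hGH j
      by_cases h1 : j ∈ G <;> by_cases h2 : j ∈ H <;> simp_all [ind]
    rw [Finset.mem_convexHull'] at hv'
    obtain ⟨w, hw0, hw1, hwv⟩ := hv'
    rw [Finset.sum_image hinj.injOn] at hw1 hwv
    refine ⟨fun G => w (ind G), fun G hG => hw0 _ (Finset.mem_image_of_mem _ hG), hw1, fun j => ?_⟩
    refine (hvt j).trans_eq ?_
    rw [← hwv]
    simp [ind, Finset.sum_apply]

/-- The stochastic matrix `A = diag p + P` can be multiplied on the left by a stochastic matrix `B`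
so that `B * A` is one third of the identity plus a matrix with equal rows. The proof takes
`B = A⁻¹ / 3 + 2 / (3m)`, where `m` is the cardinality of `J`: the entries of `A⁻¹` are at least
`-2 / m` because `A` is bounded below for the `ℓ¹` norm. -/
theorem exists_stochastic_mul_eq {J : Type*} [Fintype J] [DecidableEq J] [Nonempty J]
    (p : J → ℝ) (P : J → J → ℝ) (hp : ∀ j, 3 / 4 ≤ p j) (hP0 : ∀ j k, 0 ≤ P j k)
    (hP : ∀ j k, P j k ≤ 1 / (3 * Fintype.card J)) (hsum : ∀ j, p j + ∑ k, P j k = 1) :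
    ∃ (B : J → J → ℝ) (c : J → ℝ), (∀ j k, 0 ≤ B j k) ∧ (∀ j, ∑ k, B j k = 1) ∧
      ∀ j l, ∑ k, B j k * ((if k = l then p k else 0) + P k l) =
        (if j = l then 1 / 3 else 0) + c l := by
  set m : ℝ := (Fintype.card J : ℝ) with hm
  have hm0 : 0 < m := by rw [hm]; exact_mod_cast Fintype.card_pos
  let A : Matrix J J ℝ := Matrix.diagonal p + Matrix.of P
  have hA : ∀ (z : J → ℝ) j, (A.mulVec z) j = p j * z j + ∑ l, P j l * z l := by
    intro z j
    simp [A, Matrix.add_mulVec, Matrix.mulVec_diagonal]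
    rfl
  have hPs : ∀ (z : J → ℝ) j, |∑ l, P j l * z l| ≤ (∑ l, |z l|) / (3 * m) := by
    intro z j
    refine (Finset.abs_sum_le_sum_abs _ _).trans ?_
    rw [Finset.sum_div]
    refine Finset.sum_le_sum fun l _ => ?_
    rw [abs_mul, abs_of_nonneg (hP0 j l)]
    calc P j l * |z l| ≤ (1 / (3 * m)) * |z l| := by gcongr; exact hP j l
      _ = |z l| / (3 * m) := by ring
  -- `A` is bounded below for the `ℓ¹` norm: the diagonal contributes at least `3 / 4`, the columns
  -- of `P` at most `1 / 3`.
  have hl1 : ∀ z : J → ℝ, 5 / 12 * ∑ l, |z l| ≤ ∑ l, |A.mulVec z l| := by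
    intro z
    have h1 : ∀ j, 3 / 4 * |z j| - (∑ l, |z l|) / (3 * m) ≤ |A.mulVec z j| := by
      intro j
      rw [hA]
      have h2 := abs_sub_abs_le_abs_sub (p j * z j) (-∑ l, P j l * z l)
      rw [abs_neg, sub_neg_eq_add, abs_mul, abs_of_nonneg (by linarith [hp j] : 0 ≤ p j)] at h2
      have h3 := hPs z j
      have h4 : 3 / 4 * |z j| ≤ p j * |z j| := by gcongr; exact hp j
      linarith
    have h5 := Finset.sum_le_sum fun j (_ : j ∈ Finset.univ) => h1 j
    rw [Finset.sum_sub_distrib, ← Finset.mul_sum, Finset.sum_const, Finset.card_univ,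
      nsmul_eq_mul, ← hm] at h5
    have h6 : m * ((∑ l, |z l|) / (3 * m)) = (∑ l, |z l|) / 3 := by field_simp
    linarith
  have hinj : Function.Injective A.mulVec := by
    refine (injective_iff_map_eq_zero A.mulVecLin).2 fun z hz => ?_
    have hz' : A.mulVec z = 0 := hz
    have := hl1 z
    rw [hz'] at this
    simp only [Pi.zero_apply, abs_zero, Finset.sum_const_zero] at this
    have h0 : ∑ l, |z l| = 0 :=
      le_antisymm (by linarith) (Finset.sum_nonneg fun _ _ => abs_nonneg _)
    ext l
    exact abs_eq_zero.1 ((Finset.sum_eq_zero_iff_of_nonneg fun _ _ => abs_nonneg _).1 h0 l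
      (Finset.mem_univ l))
  have hunit : IsUnit A := Matrix.mulVec_injective_iff_isUnit.1 hinj
  have hdet : IsUnit A.det := (Matrix.isUnit_iff_isUnit_det A).1 hunit
  let Z := A⁻¹
  have hAZ : A * Z = 1 := Matrix.mul_nonsing_inv A hdet
  have hZA : Z * A = 1 := Matrix.nonsing_inv_mul A hdet
  have hZlow : ∀ j k, -(2 / m) ≤ Z j k := by
    intro j k
    have hcol : ∀ i, A.mulVec (fun l => Z l k) i = if i = k then 1 else 0 := by
      intro i
      have := congrFun (congrFun hAZ i) k
      rw [Matrix.one_apply] at this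
      exact this
    have h1 := hl1 fun l => Z l k
    simp only [hcol] at h1
    have h2 : ∑ l : J, |if l = k then (1 : ℝ) else 0| = 1 := by
      simp [apply_ite abs]
    rw [h2] at h1
    have h3 := hcol j
    rw [hA] at h3
    have h4 := (abs_le.1 (hPs (fun l => Z l k) j)).2
    have h5 : (∑ l, |Z l k|) / (3 * m) ≤ (12 / 5) / (3 * m) := by gcongr; linarith
    have h6 : (12 / 5) / (3 * m) = (4 / 5) / m := by field_simp; norm_num
    have h7 : (0 : ℝ) ≤ if j = k then 1 else 0 := by split_ifs <;> norm_num
    have h8 : -((4 / 5) / m) ≤ p j * Z j k := by linarith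
    by_contra! hlt
    have h9 : p j * Z j k ≤ 3 / 4 * Z j k := by
      have : Z j k < 0 := hlt.trans (by have : 0 < 2 / m := by positivity
                                        linarith)
      nlinarith [hp j]
    have h10 : 4 / 5 / m = 2 / 5 * (2 / m) := by ring
    have : 0 < 2 / m := by positivity
    linarith
  have hZsum : ∀ j, ∑ k, Z j k = 1 := by
    intro j
    have h1 : A.mulVec (fun _ => 1) = fun _ => 1 := by
      ext i; rw [hA]; simp [hsum]
    have h2 : Z.mulVec (A.mulVec fun _ => 1) = fun _ => 1 := by
      rw [Matrix.mulVec_mulVec, hZA, Matrix.one_mulVec]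
    rw [h1] at h2
    simpa [Matrix.mulVec, dotProduct] using congrFun h2 j
  refine ⟨fun j k => 1 / 3 * Z j k + 2 / (3 * m), fun l => ∑ k, 2 / (3 * m) * A k l, ?_, ?_, ?_⟩
  · intro j k
    have h1 := hZlow j k
    have : 2 / (3 * m) = 1 / 3 * (2 / m) := by field_simp
    rw [this]; linarith
  · intro j
    rw [Finset.sum_add_distrib, ← Finset.mul_sum, hZsum, Finset.sum_const, Finset.card_univ,
      nsmul_eq_mul, ← hm]
    field_simp; norm_num
  · intro j l
    have hAkl : ∀ k, (if k = l then p k else 0) + P k l = A k l := by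
      intro k; simp [A, Matrix.diagonal_apply]
    have h1 := congrFun (congrFun hZA j) l
    rw [Matrix.mul_apply, Matrix.one_apply] at h1
    simp only [hAkl, add_mul, Finset.sum_add_distrib, mul_assoc]
    rw [← Finset.mul_sum, h1]
    simp

/-- If a finite family `f` has no translate in the convex set `E`, then `3 • f` carries a
distribution giving mass at most `7 / 8` to every translate of `E`. It is essential that neither
constant depends on the number of points. -/
theorem exists_weights_of_no_translate {X J : Type*} [AddCommGroup X] [Module ℝ X]
    [Fintype J] [DecidableEq J] [Nonempty J] {E : Set X} (hE : Convex ℝ E) (f : J → X)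
    (hf : ¬ ∃ x, ∀ j, x + f j ∈ E) :
    ∃ w : J → ℝ, (∀ j, 0 ≤ w j) ∧ ∑ j, w j = 1 ∧
      ∀ (x : X) (G : Finset J), (∀ j ∈ G, x + (3 : ℝ) • f j ∈ E) → ∑ j ∈ G, w j ≤ 7 / 8 := by
  classical
  by_contra! hcon
  apply hf
  set m : ℝ := (Fintype.card J : ℝ) with hm
  have hm0 : 0 < m := by rw [hm]; exact_mod_cast Fintype.card_pos
  let 𝒢 : Finset (Finset J) := {G | 3 / 4 * m ≤ G.card ∧ ∃ x : X, ∀ j ∈ G, x + (3 : ℝ) • f j ∈ E}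
  have hmem : ∀ {G}, G ∈ 𝒢 ↔ 3 / 4 * m ≤ G.card ∧ ∃ x : X, ∀ j ∈ G, x + (3 : ℝ) • f j ∈ E := by
    intro G; simp [𝒢]
  obtain ⟨q, hq0, hq1, hq⟩ := exists_weights_cover 𝒢 (3 / 4) (by
    intro w hw0 hw1
    -- Mixing `w` with the uniform distribution makes `G` large for both: a mass greater than `7 / 8`
    -- of the mixture forces a mass greater than `3 / 4` of each component.
    obtain ⟨x, G, hG, hlt⟩ := hcon (fun j => (w j + m⁻¹) / 2)
      (fun j => by have := hw0 j; positivity)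
      (by
        rw [← Finset.sum_div, Finset.sum_add_distrib, hw1, Finset.sum_const, Finset.card_univ,
          nsmul_eq_mul, ← hm, mul_inv_cancel₀ hm0.ne']; norm_num)
    rw [← Finset.sum_div, Finset.sum_add_distrib, Finset.sum_const, nsmul_eq_mul] at hlt
    have h1 : ∑ j ∈ G, w j ≤ 1 := by
      rw [← hw1]
      exact Finset.sum_le_sum_of_subset_of_nonneg (Finset.subset_univ _) fun j _ _ => hw0 j
    have hGm : (G.card : ℝ) ≤ m := by rw [hm]; exact_mod_cast Finset.card_le_univ G
    have h2 : (G.card : ℝ) * m⁻¹ ≤ 1 := by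
      rw [← div_eq_mul_inv, div_le_one hm0]; exact hGm
    refine ⟨G, hmem.2 ⟨?_, x, hG⟩, by linarith⟩
    have h3 : 3 / 4 ≤ (G.card : ℝ) * m⁻¹ := by linarith
    rwa [← div_eq_mul_inv, le_div_iff₀ hm0] at h3)
  have hx : ∀ G ∈ 𝒢, ∃ x : X, ∀ j ∈ G, x + (3 : ℝ) • f j ∈ E := fun G hG => (hmem.1 hG).2
  choose! x hx using hx
  have hcard : ∀ G ∈ 𝒢, 0 < (G.card : ℝ) := fun G hG =>
    lt_of_lt_of_le (by positivity) (hmem.1 hG).1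
  -- For a set `G` translated into `E`, row `j` of `W G` is the point mass at `j` if `j ∈ G`, and the
  -- uniform distribution on `G` otherwise.
  let W : Finset J → J → J → ℝ := fun G j k =>
    if j ∈ G then (if j = k then 1 else 0) else (if k ∈ G then (G.card : ℝ)⁻¹ else 0)
  let p : J → ℝ := fun j => ∑ G ∈ 𝒢, if j ∈ G then q G else 0
  let P : J → J → ℝ := fun j k =>
    ∑ G ∈ 𝒢, if j ∈ G then 0 else if k ∈ G then q G * (G.card : ℝ)⁻¹ else 0
  have hWA : ∀ j k, ∑ G ∈ 𝒢, q G * W G j k = (if j = k then p j else 0) + P j k := by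
    intro j k
    by_cases hjk : j = k
    · subst hjk
      simp only [if_true, p, P, ← Finset.sum_add_distrib]
      refine Finset.sum_congr rfl fun G _ => ?_
      by_cases hj : j ∈ G <;> simp [W, hj]
    · simp only [if_neg hjk, P, zero_add]
      refine Finset.sum_congr rfl fun G _ => ?_
      by_cases hj : j ∈ G <;> by_cases hk : k ∈ G <;> simp [W, hj, hk, hjk]
  have hW1 : ∀ G ∈ 𝒢, ∀ j, ∑ k, W G j k = 1 := by
    intro G hG j
    have := hcard G hG
    by_cases hj : j ∈ G
    · simp [W, hj]
    · simp [W, hj, this.ne']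
  have hWE : ∀ G ∈ 𝒢, ∀ j, x G + (3 : ℝ) • ∑ k, W G j k • f k ∈ E := by
    intro G hG j
    have h1 : x G + (3 : ℝ) • ∑ k, W G j k • f k = ∑ k ∈ G, W G j k • (x G + (3 : ℝ) • f k) := by
      have hz : ∀ k, k ∉ G → W G j k = 0 := by
        intro k hk
        by_cases hj : j ∈ G
        · have : j ≠ k := fun h => hk (h ▸ hj)
          simp [W, hj, this]
        · simp [W, hj, hk]
      have h2 : ∑ k, W G j k • (x G + (3 : ℝ) • f k) =
          ∑ k ∈ G, W G j k • (x G + (3 : ℝ) • f k) :=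
        (Finset.sum_subset (Finset.subset_univ G) fun k _ hk => by rw [hz k hk, zero_smul]).symm
      rw [← h2]
      simp only [smul_add, Finset.sum_add_distrib, ← Finset.sum_smul, hW1 G hG j, one_smul,
        Finset.smul_sum]
      congr 1
      refine Finset.sum_congr rfl fun k _ => smul_comm _ _ _
    rw [h1]
    refine hE.sum_mem (fun k _ => ?_) ?_ fun k hk => hx G hG k hk
    · simp only [W]; split_ifs <;> positivity
    · rw [← hW1 G hG j]
      refine Finset.sum_subset (Finset.subset_univ G) fun k _ hk => ?_
      by_cases hj : j ∈ G
      · have : j ≠ k := fun h => hk (h ▸ hj)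
        simp [W, hj, this]
      · simp [W, hj, hk]
  have hpP : ∀ j, p j + ∑ k, P j k = 1 := by
    intro j
    have h1 : ∑ k, ∑ G ∈ 𝒢, q G * W G j k = 1 := by
      rw [Finset.sum_comm]
      simp only [← Finset.mul_sum]
      rw [← hq1]
      exact Finset.sum_congr rfl fun G hG => by rw [hW1 G hG, mul_one]
    simp only [hWA, Finset.sum_add_distrib, Finset.sum_ite_eq, Finset.mem_univ, if_true] at h1
    exact h1
  have hP0 : ∀ j k, 0 ≤ P j k := by
    intro j k
    refine Finset.sum_nonneg fun G hG => ?_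
    have := hq0 G hG
    split_ifs <;> positivity
  have hPle : ∀ j k, P j k ≤ 1 / (3 * Fintype.card J) := by
    intro j k
    have h1 : P j k ≤ ∑ G ∈ 𝒢, (q G - if j ∈ G then q G else 0) * (4 / (3 * m)) := by
      refine Finset.sum_le_sum fun G hG => ?_
      have hqG := hq0 G hG
      by_cases hj : j ∈ G
      · simp [hj]
      · simp only [hj, if_false, sub_zero]
        have h2 : (G.card : ℝ)⁻¹ ≤ 4 / (3 * m) := by
          have h3 := (hmem.1 hG).1
          calc (G.card : ℝ)⁻¹ ≤ (3 / 4 * m)⁻¹ := inv_anti₀ (by positivity) h3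
            _ = 4 / (3 * m) := by field_simp
        split_ifs
        · gcongr
        · positivity
    rw [← Finset.sum_mul, Finset.sum_sub_distrib, hq1] at h1
    have h4 := hq j
    calc P j k ≤ _ := h1
      _ ≤ 1 / 4 * (4 / (3 * m)) := by gcongr; linarith
      _ = 1 / (3 * Fintype.card J) := by rw [← hm]; field_simp
  obtain ⟨B, c, hB0, hB1, hB⟩ := exists_stochastic_mul_eq p P hq hP0 hPle hpP
  -- The averaged points `h j` of `E` have coefficient matrix `diag p + P`.
  let h : J → X := fun j => ∑ G ∈ 𝒢, q G • (x G + (3 : ℝ) • ∑ k, W G j k • f k)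
  have hh : ∀ j, h j ∈ E := fun j => hE.sum_mem hq0 hq1 fun G hG => hWE G hG j
  have hh' : ∀ j, h j = ∑ G ∈ 𝒢, q G • x G +
      (3 : ℝ) • ∑ k, ((if j = k then p j else 0) + P j k) • f k := by
    intro j
    simp only [h, smul_add, Finset.sum_add_distrib, ← hWA, Finset.sum_smul]
    congr 1
    rw [Finset.sum_comm, Finset.smul_sum]
    refine Finset.sum_congr rfl fun G _ => ?_
    rw [smul_comm, Finset.smul_sum]
    simp only [smul_smul]
  refine ⟨∑ G ∈ 𝒢, q G • x G + (3 : ℝ) • ∑ l, c l • f l, fun j => ?_⟩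
  have hmemE : ∑ k, B j k • h k ∈ E := hE.sum_mem (fun k _ => hB0 j k) (hB1 j) fun k _ => hh k
  convert hmemE using 1
  simp only [hh', smul_add, Finset.sum_add_distrib, ← Finset.sum_smul, hB1, one_smul]
  rw [add_assoc]
  congr 1
  have h1 : ∑ k, B j k • (3 : ℝ) • ∑ l, ((if k = l then p k else 0) + P k l) • f l =
      (3 : ℝ) • ∑ l, (∑ k, B j k * ((if k = l then p k else 0) + P k l)) • f l := by
    simp only [Finset.sum_smul]
    rw [Finset.sum_comm, Finset.smul_sum]
    refine Finset.sum_congr rfl fun k _ => ?_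
    rw [smul_comm, Finset.smul_sum]
    simp only [smul_smul]
  rw [h1]
  simp only [hB, add_smul, Finset.sum_add_distrib, smul_add, ite_smul, zero_smul,
    Finset.sum_ite_eq, Finset.mem_univ, if_true, smul_smul]
  norm_num
  exact add_comm _ _

/-! ### Random series -/

section
open ProbabilityTheory Filter

variable {X : Type*} [NormedAddCommGroup X] [CompleteSpace X]
  [TopologicalSpace.SeparableSpace X] [MeasurableSpace X] [BorelSpace X]
  {ι : ℕ → Type*} [∀ n, MeasurableSpace (ι n)]

/-- A coordinate of an infinite product measure is independent of the family of all the others. -/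
theorem indepFun_eval_restrict_compl (P : ∀ n, Measure (ι n)) [∀ n, IsProbabilityMeasure (P n)]
    (n : ℕ) :
    IndepFun (fun ω : (∀ k, ι k) => fun k : {k // k ≠ n} => ω k) (fun ω => ω n)
      (Measure.infinitePi P) := by
  have h1 : iIndepFun (fun i (ω : ∀ k, ι k) => ω i) (Measure.infinitePi P) :=
    iIndepFun_infinitePi (X := fun i (x : ι i) => x) (fun i => measurable_id)
  have h2 := indep_iSup_of_disjoint (S := {k | k ≠ n}) (T := {n})
    (fun i => (measurable_pi_apply i).comap_le) h1 (by simp)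
  refine indep_of_indep_of_le_left (indep_of_indep_of_le_right h2 ?_) ?_
  · exact le_iSup₂_of_le n rfl le_rfl
  · simp only [MeasurableSpace.pi, MeasurableSpace.comap_iSup, MeasurableSpace.comap_comp]
    exact iSup_le fun k => le_iSup₂_of_le (f := fun i (_ : i ∈ {k | k ≠ n}) =>
      MeasurableSpace.comap (fun ω : (∀ k, ι k) => ω i) inferInstance) k.1 k.2 le_rfl

/-- The conditional probability that `Y + a n (ω n)` lies in `E`, given an event `D` and a vector
`Y` which depend only on the coordinates other than `n`, is at most the largest mass that the law of
the `n`-th term gives to a translate of `E`. -/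
theorem measure_random_sum_mem_le (P : ∀ n, Measure (ι n)) [∀ n, IsProbabilityMeasure (P n)]
    (a : ∀ n, ι n → X) (ha : ∀ n, Measurable (a n)) {E : Set X} (hE : IsClosed E) (n : ℕ)
    (c : ENNReal) (hc : ∀ x, P n {i | x + a n i ∈ E} ≤ c)
    (Y : (∀ k : {k // k ≠ n}, ι k) → X) (hY : Measurable Y)
    {D : Set (∀ k : {k // k ≠ n}, ι k)} (hD : MeasurableSet D) :
    Measure.infinitePi P {ω | (fun k : {k // k ≠ n} => ω k) ∈ D ∧
      Y (fun k => ω k) + a n (ω n) ∈ E} ≤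
    c * Measure.infinitePi P {ω | (fun k : {k // k ≠ n} => ω k) ∈ D} := by
  set μ := Measure.infinitePi P
  set r : (∀ k, ι k) → (∀ k : {k // k ≠ n}, ι k) := fun ω k => ω k with hr
  have hrm : Measurable r := by fun_prop
  have hprod := (indepFun_iff_map_prod_eq_prod_map_map hrm.aemeasurable
    (measurable_pi_apply n).aemeasurable).1 (indepFun_eval_restrict_compl P n)
  rw [Measure.infinitePi_map_eval] at hprod
  have hT : MeasurableSet {z : (∀ k : {k // k ≠ n}, ι k) × ι n | z.1 ∈ D ∧ Y z.1 + a n z.2 ∈ E} := by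
    refine (hD.preimage measurable_fst).inter ?_
    have : Measurable fun z : (∀ k : {k // k ≠ n}, ι k) × ι n => Y z.1 + a n z.2 :=
      (hY.comp measurable_fst).add ((ha n).comp measurable_snd)
    exact this hE.measurableSet
  have h1 : μ {ω | r ω ∈ D ∧ Y (r ω) + a n (ω n) ∈ E} =
      ∫⁻ y, P n (Prod.mk y ⁻¹' {z : (∀ k : {k // k ≠ n}, ι k) × ι n |
        z.1 ∈ D ∧ Y z.1 + a n z.2 ∈ E}) ∂(μ.map r) := by
    rw [← Measure.prod_apply hT, ← hprod,
      Measure.map_apply (hrm.prodMk (measurable_pi_apply n)) hT]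
    rfl
  calc μ {ω | r ω ∈ D ∧ Y (r ω) + a n (ω n) ∈ E} = _ := h1
    _ ≤ ∫⁻ y, D.indicator (fun _ => c) y ∂(μ.map r) := by
        refine lintegral_mono fun y => ?_
        by_cases hy : y ∈ D
        · simp only [hy, Set.indicator_of_mem, Set.preimage_ofPred_eq, true_and]
          exact hc _
        · simp [hy]
    _ = c * μ {ω | r ω ∈ D} := by
        rw [lintegral_indicator_const hD, Measure.map_apply hrm hD]
        rfl

/-- If all terms of a random series from some index on have laws giving mass at most `c < 1` to each
translate of the closed set `E`, then the sum almost surely avoids `E`. This replaces a zero-one law: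
`E` being closed, the event is a limit of events `B n` depending on the first `n` terms only. -/
theorem measure_random_series_mem_eq_zero (P : ∀ n, Measure (ι n))
    [∀ n, IsProbabilityMeasure (P n)] (a : ∀ n, ι n → X) (ha : ∀ n, Measurable (a n))
    (ρ : ℕ → ℝ) (hρ : Summable ρ) (haρ : ∀ n i, ‖a n i‖ ≤ ρ n) {E : Set X} (hE : IsClosed E)
    {c : ENNReal} (hc1 : c < 1) {N : ℕ} (hc : ∀ n ≥ N, ∀ x, P n {i | x + a n i ∈ E} ≤ c) :
    Measure.infinitePi P {ω | ∑' n, a n (ω n) ∈ E} = 0 := by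
  rcases E.eq_empty_or_nonempty with rfl | hne
  · simp
  set μ := Measure.infinitePi P
  have hsum : ∀ ω : (∀ k, ι k), Summable fun n => a n (ω n) := fun ω =>
    Summable.of_norm_bounded hρ fun n => haρ n (ω n)
  set A : Set (∀ k, ι k) := {ω | ∑' n, a n (ω n) ∈ E}
  set τ : ℕ → ℝ := fun n => ∑' k, ρ (k + n)
  -- `B n` says that the first `n` terms do not yet exclude that the sum lies in `E`.
  let B : ℕ → Set (∀ k, ι k) := fun n =>
    {ω | Metric.infDist (∑ k ∈ Finset.range n, a k (ω k)) E ≤ τ n}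
  have htail : ∀ n (ω : ∀ k, ι k),
      ‖∑' k, a k (ω k) - ∑ k ∈ Finset.range n, a k (ω k)‖ ≤ τ n := by
    intro n ω
    rw [← (hsum ω).sum_add_tsum_nat_add n, add_sub_cancel_left]
    exact tsum_of_norm_bounded ((summable_nat_add_iff n).2 hρ).hasSum fun k => haρ _ _
  have hAB : ∀ n, A ⊆ B n := by
    intro n ω hω
    have hω' : ∑' n, a n (ω n) ∈ E := hω
    refine (Metric.infDist_le_dist_of_mem hω').trans ?_
    rw [dist_comm, dist_eq_norm]
    exact htail n ω
  have hBm : ∀ n, MeasurableSet (B n) := by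
    intro n
    refine measurableSet_le ?_ measurable_const
    refine (Metric.continuous_infDist_pt E).measurable.comp ?_
    exact Finset.measurable_sum _ fun k _ => (ha k).comp (measurable_pi_apply k)
  have hτ : Tendsto τ atTop (𝓝 0) := tendsto_sum_nat_add ρ
  have hstep : ∀ n ≥ N, μ A ≤ c * μ (B n) := by
    intro n hn
    -- the sum of all terms but the `n`-th, and the event `B n`, as functions of the coordinates
    -- other than `n`
    let Y : (∀ k : {k // k ≠ n}, ι k) → X := fun y =>
      ∑' k, if h : k ≠ n then a k (y ⟨k, h⟩) else 0
    let D : Set (∀ k : {k // k ≠ n}, ι k) := {y |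
      Metric.infDist (∑ k ∈ Finset.range n, if h : k ≠ n then a k (y ⟨k, h⟩) else 0) E ≤ τ n}
    have hterm : ∀ k, Measurable fun y : (∀ k : {k // k ≠ n}, ι k) =>
        if h : k ≠ n then a k (y ⟨k, h⟩) else 0 := by
      intro k
      by_cases h : k ≠ n
      · simp only [h, dif_pos, ne_eq, not_false_eq_true]
        exact (ha k).comp (measurable_pi_apply _)
      · simp only [h, dif_neg, not_false_eq_true]
        exact measurable_const
    have hYsum : ∀ y : (∀ k : {k // k ≠ n}, ι k),
        Summable fun k => if h : k ≠ n then a k (y ⟨k, h⟩) else 0 := by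
      intro y
      refine Summable.of_norm_bounded_eventually_nat hρ ?_
      filter_upwards [eventually_gt_atTop n] with k hk
      rw [dif_pos hk.ne']
      exact haρ _ _
    have hY : Measurable Y := by
      refine measurable_of_tendsto_metrizable
        (f := fun m y => ∑ k ∈ Finset.range m, if h : k ≠ n then a k (y ⟨k, h⟩) else 0)
        (fun m => Finset.measurable_sum _ fun k _ => hterm k) ?_
      rw [tendsto_pi_nhds]
      intro y
      exact (hYsum y).hasSum.tendsto_sum_nat
    have hD : MeasurableSet D := by
      refine measurableSet_le ?_ measurable_const
      refine (Metric.continuous_infDist_pt E).measurable.comp ?_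
      exact Finset.measurable_sum _ fun k _ => hterm k
    have key := measure_random_sum_mem_le P a ha hE n c (hc n hn) Y hY hD
    have hBD : {ω : ∀ k, ι k | (fun k : {k // k ≠ n} => ω k) ∈ D} = B n := by
      ext ω
      have : (∑ k ∈ Finset.range n, if h : k ≠ n then a k (ω k) else 0) =
          ∑ k ∈ Finset.range n, a k (ω k) :=
        Finset.sum_congr rfl fun k hk => by
          rw [dif_pos (Finset.mem_range.1 hk).ne]
      simp only [D, B, Set.mem_ofPred_eq, this]
    rw [hBD] at key
    refine (measure_mono fun ω hω => And.intro ?_ ?_).trans key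
    · have := hAB n hω
      rw [← hBD] at this
      exact this
    · have h1 := (hsum ω).tsum_eq_add_tsum_ite n
      have h2 : Y (fun k => ω k) + a n (ω n) = ∑' k, a k (ω k) := by
        rw [h1, add_comm]
        congr 1
        refine tsum_congr fun k => ?_
        by_cases h : k = n <;> simp [h]
      rw [h2]
      exact hω
  -- the events `B n` shrink to the event itself because `E` is closed
  have hlim : Tendsto (fun n => μ (B n)) atTop (𝓝 (μ A)) := by
    refine tendsto_measure_of_tendsto_indicator_of_isFiniteMeasure atTop μ hBm fun ω => ?_
    by_cases hω : ω ∈ A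
    · exact Eventually.of_forall fun n => iff_of_true (hAB n hω) hω
    · have hpos : 0 < Metric.infDist (∑' n, a n (ω n)) E :=
        (hE.notMem_iff_infDist_pos hne).1 hω
      have h1 : Tendsto (fun n => Metric.infDist (∑ k ∈ Finset.range n, a k (ω k)) E) atTop
          (𝓝 (Metric.infDist (∑' n, a n (ω n)) E)) :=
        ((Metric.continuous_infDist_pt E).tendsto _).comp (hsum ω).hasSum.tendsto_sum_nat
      filter_upwards [hτ.eventually_lt h1 hpos] with n hn
      exact iff_of_false (not_le.2 hn) hω
  have hle : μ A ≤ c * μ A :=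
    ge_of_tendsto (ENNReal.Tendsto.const_mul hlim (Or.inr (hc1.trans ENNReal.one_lt_top).ne))
      (eventually_atTop.2 ⟨N, hstep⟩)
  by_contra h0
  have : c * μ A < 1 * μ A := (ENNReal.mul_lt_mul_iff_left h0 (measure_ne_top _ _)).2 hc1
  rw [one_mul] at this
  exact absurd hle (not_le.2 this)
end

/-! ### Translating compact sets -/

section
open Filter

/-- If all finite subsets of the ball of radius `r` have translates in `C`, by vectors of bounded
norm, then so do all compact subsets of the ball of radius `r / 2`. The approximations of a point at
scales `4⁻ⁿ` telescope, and the weights `2⁻⁽ⁿ⁺¹⁾` turn the increments into a convex combination of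
points of finite sets; boundedness makes the weighted series of translations converge. -/
theorem exists_translate_subset_of_isCompact {X : Type*} [NormedAddCommGroup X] [NormedSpace ℝ X]
    [CompleteSpace X] {C : Set X} (hC : IsClosed C) (hconv : Convex ℝ C) {r L : ℝ} (hr : 0 < r)
    (h : ∀ F : Finset X, (∀ y ∈ F, ‖y‖ ≤ r) → ∃ x, ‖x‖ ≤ L ∧ ∀ y ∈ F, x + y ∈ C)
    {K : Set X} (hK : IsCompact K) (hKr : ∀ k ∈ K, ‖k‖ ≤ r / 2) :
    ∃ x, ∀ k ∈ K, x + k ∈ C := by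
  have hnet : ∀ n : ℕ, ∃ (s : X → X) (T : Set X), T.Finite ∧
      ∀ k ∈ K, s k ∈ T ∧ s k ∈ K ∧ ‖k - s k‖ ≤ r / 8 * (1 / 4) ^ n := by
    intro n
    obtain ⟨T, hTK, hTf, hcov⟩ := hK.finite_cover_balls
      (show 0 < r / 8 * (1 / 4) ^ n by positivity)
    have : ∀ k ∈ K, ∃ t, t ∈ T ∧ t ∈ K ∧ ‖k - t‖ ≤ r / 8 * (1 / 4) ^ n := by
      intro k hk
      obtain ⟨t, ht, hkt⟩ := mem_iUnion₂.1 (hcov hk)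
      exact ⟨t, ht, hTK ht, by rw [← dist_eq_norm]; exact (Metric.mem_ball.1 hkt).le⟩
    choose! s hs using this
    exact ⟨s, T, hTf, hs⟩
  choose s T hT hs using hnet
  -- the increments of the approximations, rescaled so as to stay in the ball of radius `r`
  let z : ℕ → X → X := fun n k => Nat.casesOn n ((2 : ℝ) • s 0 k)
    fun m => (2 : ℝ) ^ (m + 2) • (s (m + 1) k - s m k)
  have hzr : ∀ n, ∀ k ∈ K, ‖z n k‖ ≤ r := by
    intro n k hk
    cases n with
    | zero =>
      change ‖(2 : ℝ) • s 0 k‖ ≤ r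
      rw [norm_smul, Real.norm_ofNat]
      linarith [hKr _ (hs 0 k hk).2.1]
    | succ m =>
      change ‖(2 : ℝ) ^ (m + 2) • (s (m + 1) k - s m k)‖ ≤ r
      have h1 : ‖s (m + 1) k - s m k‖ ≤ 5 / 32 * r * (1 / 4) ^ m := by
        have h2 : s (m + 1) k - s m k = (k - s m k) - (k - s (m + 1) k) := by abel
        rw [h2]
        refine (norm_sub_le _ _).trans ?_
        have h3 := (hs m k hk).2.2
        have h4 := (hs (m + 1) k hk).2.2
        rw [pow_succ] at h4
        linarith
      rw [norm_smul, norm_pow, Real.norm_ofNat]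
      have h6 : (2 : ℝ) ^ m * (1 / 4) ^ m ≤ 1 := by
        rw [← mul_pow]; exact pow_le_one₀ (by norm_num) (by norm_num)
      calc (2 : ℝ) ^ (m + 2) * ‖s (m + 1) k - s m k‖
          ≤ 2 ^ (m + 2) * (5 / 32 * r * (1 / 4) ^ m) := by gcongr
        _ = 5 / 8 * r * (2 ^ m * (1 / 4) ^ m) := by ring
        _ ≤ 5 / 8 * r * 1 := by gcongr
        _ ≤ r := by linarith
  have hzf : ∀ n, (z n '' K).Finite := by
    intro n
    cases n with
    | zero =>
      refine ((hT 0).image fun t => (2 : ℝ) • t).subset ?_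
      rintro _ ⟨k, hk, rfl⟩
      exact ⟨s 0 k, (hs 0 k hk).1, rfl⟩
    | succ m =>
      refine (((hT (m + 1)).prod (hT m)).image
        fun t => (2 : ℝ) ^ (m + 2) • (t.1 - t.2)).subset ?_
      rintro _ ⟨k, hk, rfl⟩
      exact ⟨(s (m + 1) k, s m k), ⟨(hs (m + 1) k hk).1, (hs m k hk).1⟩, rfl⟩
  have hx : ∀ n, ∃ x, ‖x‖ ≤ L ∧ ∀ k ∈ K, x + z n k ∈ C := by
    intro n
    obtain ⟨x, hxL, hx⟩ := h (hzf n).toFinset (by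
      intro y hy
      obtain ⟨k, hk, rfl⟩ := (hzf n).mem_toFinset.1 hy
      exact hzr n k hk)
    exact ⟨x, hxL, fun k hk => hx _ ((hzf n).mem_toFinset.2 ⟨k, hk, rfl⟩)⟩
  choose x hxL hxC using hx
  have hgeo : Summable fun n : ℕ => (1 / 2 : ℝ) ^ (n + 1) * L :=
    ((summable_nat_add_iff 1).2 summable_geometric_two).mul_right L
  have hsx : Summable fun n : ℕ => (1 / 2 : ℝ) ^ (n + 1) • x n := by
    refine Summable.of_norm_bounded hgeo fun n => ?_
    rw [norm_smul, norm_pow, Real.norm_of_nonneg (by norm_num : (0 : ℝ) ≤ 1 / 2)]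
    gcongr
    exact hxL n
  refine ⟨∑' n, (1 / 2 : ℝ) ^ (n + 1) • x n, fun k hk => ?_⟩
  have htel : ∀ n, ∑ i ∈ Finset.range (n + 1), (1 / 2 : ℝ) ^ (i + 1) • z i k = s n k := by
    intro n
    induction n with
    | zero => simp [z, smul_smul]
    | succ n ih =>
      rw [Finset.sum_range_succ, ih]
      change s n k + (1 / 2 : ℝ) ^ (n + 1 + 1) • ((2 : ℝ) ^ (n + 2) • (s (n + 1) k - s n k)) = _
      rw [smul_smul, ← mul_pow]
      norm_num
  have hsk : Tendsto (fun n => s n k) atTop (𝓝 k) := by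
    rw [tendsto_iff_norm_sub_tendsto_zero]
    have h0 : Tendsto (fun n : ℕ => r / 8 * (1 / 4 : ℝ) ^ n) atTop (𝓝 (r / 8 * 0)) :=
      (tendsto_pow_atTop_nhds_zero_of_lt_one (r := (1 / 4 : ℝ))
        (by norm_num) (by norm_num)).const_mul _
    rw [mul_zero] at h0
    refine squeeze_zero (fun _ => norm_nonneg _) (fun n => ?_) h0
    rw [norm_sub_rev]
    exact (hs n k hk).2.2
  have hweights : ∀ n : ℕ, ∑ i ∈ Finset.range n, (1 / 2 : ℝ) ^ (i + 1) + (1 / 2) ^ n = 1 := by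
    intro n
    induction n with
    | zero => simp
    | succ n ih => rw [Finset.sum_range_succ]; linarith [pow_succ (1 / 2 : ℝ) n]
  -- finite convex combinations, the missing mass being put on the first point
  have hmem : ∀ n : ℕ, ∑ i ∈ Finset.range (n + 1), (1 / 2 : ℝ) ^ (i + 1) • x i + s n k +
      (1 / 2 : ℝ) ^ (n + 1) • (x 0 + z 0 k) ∈ C := by
    intro n
    rw [← htel n, ← Finset.sum_add_distrib]
    simp only [← smul_add]
    have h1 := hconv.sum_mem (t := Finset.range (n + 2))
      (w := fun i => if i < n + 1 then (1 / 2 : ℝ) ^ (i + 1) else (1 / 2) ^ (n + 1))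
      (z := fun i => if i < n + 1 then x i + z i k else x 0 + z 0 k)
      (fun i _ => by positivity)
      (by
        rw [Finset.sum_range_succ]
        refine Eq.trans ?_ (hweights (n + 1))
        congr 1
        · exact Finset.sum_congr rfl fun i hi => if_pos (Finset.mem_range.1 hi)
        · simp)
      (fun i _ => by
        split_ifs
        · exact hxC i k hk
        · exact hxC 0 k hk)
    rw [Finset.sum_range_succ] at h1
    convert h1 using 2
    · refine Finset.sum_congr rfl fun i hi => ?_
      simp [Finset.mem_range.1 hi]
    · simp
  have hlim : Tendsto (fun n : ℕ => ∑ i ∈ Finset.range (n + 1), (1 / 2 : ℝ) ^ (i + 1) • x i +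
      s n k + (1 / 2 : ℝ) ^ (n + 1) • (x 0 + z 0 k)) atTop
      (𝓝 (∑' n, (1 / 2 : ℝ) ^ (n + 1) • x n + k + (0 : ℝ) • (x 0 + z 0 k))) := by
    refine ((hsx.hasSum.tendsto_sum_nat.comp (tendsto_add_atTop_nat 1)).add hsk).add ?_
    exact ((tendsto_pow_atTop_nhds_zero_of_lt_one (by norm_num) (by norm_num)).comp
      (tendsto_add_atTop_nat 1)).smul_const _
  rw [zero_smul, add_zero] at hlim
  exact hC.mem_of_tendsto hlim (Eventually.of_forall hmem)

/-! ### Haar null and Haar meagre sets -/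

theorem image_add_add_eq_preimage {X : Type*} [AddCommGroup X] (E : Set X) (g h : X) :
    (fun x => g + x + h) '' E = {y | -(g + h) + y ∈ E} := by
  ext y
  constructor
  · rintro ⟨x, hx, rfl⟩
    have : -(g + h) + (g + x + h) = x := by abel
    rwa [mem_ofPred_eq, this]
  · intro hy
    exact ⟨_, hy, by dsimp only; abel⟩

/-- The inclusion of the support of a compactly restricted witness measure is a witness for
Haar meagreness. Convexity plays no role here. -/
theorem HaarNull.haarMeagre {X : Type u} [NormedAddCommGroup X]
    [CompleteSpace X] [TopologicalSpace.SeparableSpace X] [MeasurableSpace X] [BorelSpace X]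
    {C : Set X} (hC : IsClosed C) (hnull : HaarNull C) : HaarMeagre C := by
  obtain ⟨hm, μ, hμ, hμC⟩ := hnull
  obtain ⟨K, -, hK, hμK⟩ := MeasurableSet.univ.exists_lt_isCompact_of_ne_top
    (measure_ne_top μ univ) (show 0 < μ univ by simp)
  set ν := μ.restrict K with hν
  set S := K ∩ ν.support with hS
  have hScl : IsClosed ν.support := Measure.isClosed_support
  have hScompact : IsCompact S := hK.inter_right hScl
  have hνS : ν Sᶜ = 0 := by
    rw [hS, compl_inter]
    refine measure_union_null ?_ Measure.measure_compl_support
    rw [hν, Measure.restrict_apply hK.measurableSet.compl]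
    simp
  have hSne : S.Nonempty := by
    rw [nonempty_iff_ne_empty]
    intro h0
    rw [h0, compl_empty, hν, Measure.restrict_apply_univ] at hνS
    exact hμK.ne' hνS
  refine ⟨hm, S, inferInstance, isCompact_iff_compactSpace.1 hScompact, hSne.to_subtype,
    Subtype.val, continuous_subtype_val, fun g h => IsNowhereDense.isMeagre ?_⟩
  have hEcl : IsClosed ((fun x => g + x + h) '' C) := by
    rw [image_add_add_eq_preimage]
    exact hC.preimage (by fun_prop)
  rw [(hEcl.preimage continuous_subtype_val).isNowhereDense_iff]
  by_contra hint
  obtain ⟨y, hy⟩ := nonempty_iff_ne_empty.2 hint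
  obtain ⟨U, hU, hUE⟩ := mem_nhds_subtype _ _ _ |>.1 (mem_interior_iff_mem_nhds.1 hy)
  have hpos : 0 < ν U := (Measure.mem_support_iff_forall _).1 y.2.2 U hU
  have h1 : ν U ≤ μ ((fun x => g + x + h) '' C) + ν Sᶜ := by
    calc ν U ≤ ν (((fun x => g + x + h) '' C) ∪ Sᶜ) := by
          refine measure_mono fun u hu => ?_
          by_cases huS : u ∈ S
          · exact Or.inl (hUE (a := ⟨u, huS⟩) hu)
          · exact Or.inr huS
      _ ≤ ν ((fun x => g + x + h) '' C) + ν Sᶜ := measure_union_le _ _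
      _ ≤ _ := by gcongr; exact Measure.restrict_le_self
  rw [hμC, hνS, add_zero] at h1
  exact hpos.ne' (le_antisymm h1 zero_le)

theorem not_haarMeagre_of_finite_translates {X : Type u} [NormedAddCommGroup X] [NormedSpace ℝ X]
    [CompleteSpace X] [MeasurableSpace X] [BorelSpace X]
    {C : Set X} (hC : IsClosed C) (hconv : Convex ℝ C) {r L : ℝ} (hr : 0 < r)
    (h : ∀ F : Finset X, (∀ y ∈ F, ‖y‖ ≤ r) → ∃ x, ‖x‖ ≤ L ∧ ∀ y ∈ F, x + y ∈ C) :
    ¬ HaarMeagre C := by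
  rintro ⟨-, M, _, _, ⟨m₀⟩, f, hf, hmeagre⟩
  -- `f` maps the closed neighbourhood `V` of `m₀` into a ball small enough to be translated into `C`.
  let V : Set M := {m | ‖f m - f m₀‖ ≤ r / 2}
  have hVcl : IsClosed V := isClosed_le (by fun_prop) continuous_const
  let K : Set X := (fun m => f m - f m₀) '' V
  have hK : IsCompact K := hVcl.isCompact.image (by fun_prop)
  obtain ⟨x, hx⟩ := exists_translate_subset_of_isCompact hC hconv hr h hK (by
    rintro _ ⟨m, hm, rfl⟩
    exact hm)
  let U : Set M := {m | ‖f m - f m₀‖ < r / 2}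
  have hU : IsOpen U := isOpen_lt (by fun_prop) continuous_const
  refine not_isMeagre_of_isOpen hU ⟨m₀, by simp [U, hr]⟩ ((hmeagre (f m₀ - x) 0).mono ?_)
  intro m hm
  rw [mem_preimage, image_add_add_eq_preimage]
  have h1 := hx _ ⟨m, le_of_lt (show ‖f m - f m₀‖ < r / 2 from hm), rfl⟩
  have h2 : -(f m₀ - x + 0) + f m = x + (f m - f m₀) := by abel
  rw [mem_ofPred_eq, h2]
  exact h1
end

/-- A closed convex set is Haar null unless all finite subsets of some ball can be translated into
it by vectors of bounded norm. -/
theorem haarNull_or_finite_translates {X : Type u} [NormedAddCommGroup X] [NormedSpace ℝ X]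
    [CompleteSpace X] [TopologicalSpace.SeparableSpace X] [MeasurableSpace X] [BorelSpace X]
    {C : Set X} (hC : IsClosed C) (hconv : Convex ℝ C) :
    HaarNull C ∨ ∃ r > 0, ∃ L : ℝ, ∀ F : Finset X, (∀ y ∈ F, ‖y‖ ≤ r) →
      ∃ x, ‖x‖ ≤ L ∧ ∀ y ∈ F, x + y ∈ C := by
  classical
  refine or_iff_not_imp_right.2 fun hcon => ?_
  push Not at hcon
  choose F hFr hF using fun n : ℕ => hcon ((1 / 2) ^ n) (by positivity) (n + 1)
  have hne : ∀ n, Nonempty (F n) := by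
    intro n
    by_contra! hempty
    obtain ⟨y, hy, -⟩ := hF n 0 (by rw [norm_zero]; positivity)
    exact hempty.elim ⟨y, hy⟩
  -- Truncating `C` makes the bound on the translations automatic: a translate of `F n` in `E n` is
  -- obtained by a vector of norm at most `n + 1`.
  let E : ℕ → Set X := fun n => C ∩ Metric.closedBall 0 n
  have hEconv : ∀ n, Convex ℝ (E n) := fun n => hconv.inter (convex_closedBall 0 n)
  have hEcl : ∀ n, IsClosed (E n) := fun n => hC.inter Metric.isClosed_closedBall
  have hEmono : Monotone E := fun m n hmn =>
    inter_subset_inter_right _ (Metric.closedBall_subset_closedBall (by exact_mod_cast hmn))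
  have hFE : ∀ n, ¬ ∃ x, ∀ j : F n, x + (j : X) ∈ E n := by
    rintro n ⟨x, hx⟩
    obtain ⟨y₀⟩ := hne n
    have hxn : ‖x‖ ≤ n + 1 := by
      have h1 : ‖x + (y₀ : X)‖ ≤ n := mem_closedBall_zero_iff.1 (hx y₀).2
      have h2 := hFr n y₀ y₀.2
      have h3 : ((1 : ℝ) / 2) ^ n ≤ 1 := pow_le_one₀ (by norm_num) (by norm_num)
      have h4 := norm_sub_le (x + (y₀ : X)) y₀
      rw [add_sub_cancel_right] at h4
      linarith
    obtain ⟨y, hy, hyC⟩ := hF n x hxn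
    exact hyC (hx ⟨y, hy⟩).1
  choose w hw0 hw1 hw using fun n =>
    exists_weights_of_no_translate (hEconv n) (fun j : F n => (j : X)) (hFE n)
  let P : ∀ n, Measure (F n) := fun n => ∑ j, ENNReal.ofReal (w n j) • Measure.dirac j
  have hPapply : ∀ n (s : Set (F n)), P n s = ENNReal.ofReal (∑ j with j ∈ s, w n j) := by
    intro n s
    have hs : MeasurableSet s := s.toFinite.measurableSet
    rw [ENNReal.ofReal_sum_of_nonneg fun j _ => hw0 n j, Finset.sum_filter]
    simp [P, Measure.finsetSum_apply, Measure.dirac_apply' _ hs, Set.indicator_apply]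
  have hPprob : ∀ n, IsProbabilityMeasure (P n) := fun n => ⟨by
    rw [hPapply, ← ENNReal.ofReal_one, ← hw1 n]; simp⟩
  let a : ∀ n, F n → X := fun n j => (3 : ℝ) • (j : X)
  have ha : ∀ n, Measurable (a n) := fun n => measurable_of_finite _
  have haρ : ∀ n j, ‖a n j‖ ≤ 3 * (1 / 2) ^ n := by
    intro n j
    rw [norm_smul, Real.norm_ofNat]
    gcongr
    exact hFr n j j.2
  have hρ : Summable fun n : ℕ => 3 * (1 / 2 : ℝ) ^ n := summable_geometric_two.mul_left 3
  let S : (∀ n, F n) → X := fun ω => ∑' n, a n (ω n)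
  have hS : Measurable S := by
    refine measurable_of_tendsto_metrizable
      (f := fun m ω => ∑ k ∈ Finset.range m, a k (ω k))
      (fun m => Finset.measurable_sum _ fun k _ => (ha k).comp (measurable_pi_apply k)) ?_
    rw [tendsto_pi_nhds]
    intro ω
    exact (Summable.of_norm_bounded hρ fun n => haρ n (ω n)).hasSum.tendsto_sum_nat
  have hnull : ∀ N x, Measure.infinitePi P {ω | S ω ∈ {y | x + y ∈ E N}} = 0 := by
    intro N x
    refine measure_random_series_mem_eq_zero P a ha _ hρ haρ
      ((hEcl N).preimage (by fun_prop : Continuous fun y => x + y))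
      (c := ENNReal.ofReal (7 / 8)) (ENNReal.ofReal_lt_one.2 (by norm_num)) (N := N) ?_
    intro n hn y
    rw [hPapply]
    refine ENNReal.ofReal_le_ofReal ?_
    refine hw n (x + y) _ fun j hj => ?_
    have h1 : x + (y + a n j) ∈ E N := by
      simp only [Finset.mem_filter, mem_ofPred_eq] at hj
      exact hj.2
    rw [← add_assoc] at h1
    exact hEmono hn h1
  refine ⟨hC.measurableSet, (Measure.infinitePi P).map S,
    Measure.isProbabilityMeasure_map hS.aemeasurable, fun g h => ?_⟩
  have hcover : (fun x => g + x + h) '' C ⊆ ⋃ N, {y | -(g + h) + y ∈ E N} := by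
    rw [image_add_add_eq_preimage]
    intro y hy
    obtain ⟨N, hN⟩ := exists_nat_ge ‖-(g + h) + y‖
    exact mem_iUnion.2 ⟨N, hy, mem_closedBall_zero_iff.2 hN⟩
  refine measure_mono_null hcover (measure_iUnion_null fun N => ?_)
  have hmeas : MeasurableSet {y | -(g + h) + y ∈ E N} :=
    ((hEcl N).preimage (by fun_prop : Continuous fun y => -(g + h) + y)).measurableSet
  rw [Measure.map_apply hS hmeas]
  exact hnull N _

theorem mainTheorem1 {X : Type u} [NormedAddCommGroup X] [NormedSpace ℝ X] [CompleteSpace X]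
    [TopologicalSpace.SeparableSpace X] [MeasurableSpace X] [BorelSpace X]
    (C : Set X) (hC_closed : IsClosed C) (hC_convex : Convex ℝ C) :
    (HaarPositive C ↔ ¬ HaarMeagre C) ∧ (HaarNull C ↔ HaarMeagre C) := by
  have key : HaarNull C ↔ HaarMeagre C := by
    refine ⟨HaarNull.haarMeagre hC_closed, fun hm => ?_⟩
    rcases haarNull_or_finite_translates hC_closed hC_convex with h | ⟨r, hr, L, h⟩
    · exact h
    · exact absurd hm (not_haarMeagre_of_finite_translates hC_closed hC_convex hr h)
  refine ⟨?_, key⟩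
  rw [← key]
  exact ⟨fun h => h.2, fun h => ⟨hC_closed.measurableSet, h⟩⟩
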